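/- Let $\mathcal M\subset B(\mathcal H)$ be a von Neumann algebra on a complex Hilbert space $\mathcal H$ (a unital self-adjoint subalgebra equal to its bicommutant). Let $\mathcal M_*$ be its predual, i.e. the space of all normal (ultraweakly continuous) linear forms $\mathcal M\to\mathbf C$. A form $\rho\in\mathcal M_*$ is positive if $\rho(x^*x)\ge 0$ for all $x\in\mathcal M$, and $\psi\ge\varphi$ means that $\psi-\varphi$ is positive. A POVM in $\mathcal M$ with $n$ outputs is a family $(t_1,\dots,t_n)$ of positive operators in $\mathcal M$ with $\sum_i t_i=1$. For $t\in\mathcal M$ and $\varphi\in\mathcal M_*$, let $t\varphi,\varphi t\in\mathcal M_*$ be the forms $(t\varphi)(x)=\varphi(xt)$ and $(\varphi t)(x)=\varphi(tx)$. Let $n\ge 1$ and let $\varphi_1,\dots,\varphi_n\in\mathcal M_*$ be positive. Then $$\inf\{\psi(1) \mid \psi\in\mathcal M_*,\ \psi\ge\varphi_i \text{ for all } i\}=\sup\Big\{\sum_{i=1}^n\varphi_i(t_i) \;\Big|\; (t_1,\dots,t_n)\text{ a POVM in }\mathcal M\Big\},$$ and both the infimum and the supremum are attained. Moreover, every $\psi$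 attaining the infimum and every POVM $(t_1,\dots,t_n)$ attaining the supremum satisfy $$t_i\psi=t_i\varphi_i\quad\text{and}\quad \psi t_i=\varphi_i t_i\qquad (1\le i\le n),\qquad\text{and}\qquad \psi=\sum_{i=1}^n t_i\varphi_i=\sum_{i=1}^n\varphi_i t_i .$$ -/

import Mathlib

open scoped ComplexOrder Topology

namespace VonNeumannAlgebra

variable {H : Type*} [NormedAddCommGroup H] [InnerProductSpace ℂ H] [CompleteSpace H]

/-- The ultraweak topology on a von Neumann algebra `M` acting on `H`: the smallest topology that
makes continuous all the maps `x ↦ ∑ₖ ⟨x ξₖ, ηₖ⟩`, for sequences `ξ`, `η` in `H` satisfying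
`∑ₖ ‖ξₖ‖ ‖ηₖ‖ < ∞`. It is the weak-* topology of `M`. (Mathlib's `inner` is linear in its second
argument.) -/
@[reducible]
noncomputable def ultraweakTopology (M : VonNeumannAlgebra H) : TopologicalSpace M.toStarSubalgebra :=
  ⨅ (ξ : ℕ → H) (η : ℕ → H) (_ : Summable fun k => ‖ξ k‖ * ‖η k‖),
    TopologicalSpace.induced
      (fun x : M.toStarSubalgebra => ∑' k, inner ℂ (η k) ((x : H →L[ℂ] H) (ξ k))) inferInstance

/-- The predual `M_*` of a von Neumann algebra `M`: the complex vector space of the normal, that is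
ultraweakly (weak-*) continuous, linear forms on `M`. -/
noncomputable def predual (M : VonNeumannAlgebra H) : Submodule ℂ (M.toStarSubalgebra →ₗ[ℂ] ℂ) where
  carrier := {φ | Continuous[M.ultraweakTopology, inferInstance] φ}
  add_mem' := by
    intro φ ψ hφ hψ
    let _ := M.ultraweakTopology
    exact Continuous.add (f := φ) (g := ψ) hφ hψ
  zero_mem' := by
    let _ := M.ultraweakTopology
    exact continuous_const
  smul_mem' := by
    intro c φ hφ
    let _ := M.ultraweakTopology
    exact Continuous.const_smul (g := φ) hφ c

/-- A linear form `φ` on `M` is positive if `φ (x* x) ≥ 0` for all `x ∈ M`; the order of `ℂ` is the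
one in which `0 ≤ z` means that `z` is real and nonnegative. -/
def IsPositiveForm {M : VonNeumannAlgebra H} (φ : M.predual) : Prop :=
  ∀ x : M.toStarSubalgebra, 0 ≤ φ.1 (star x * x)

theorem continuous_to_ultraweak {M : VonNeumannAlgebra H}
    {f : M.toStarSubalgebra → M.toStarSubalgebra}
    (hf : ∀ ξ η : ℕ → H, (Summable fun k => ‖ξ k‖ * ‖η k‖) →
      Continuous[M.ultraweakTopology, inferInstance]
        (fun x => ∑' k, inner ℂ (η k) ((f x : H →L[ℂ] H) (ξ k)))) :
    Continuous[M.ultraweakTopology, M.ultraweakTopology] f :=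
  continuous_iInf_rng.2 fun ξ => continuous_iInf_rng.2 fun η => continuous_iInf_rng.2 fun h =>
    continuous_induced_rng.2 (hf ξ η h)

theorem continuous_ultraweak_tsum {M : VonNeumannAlgebra H} (ξ η : ℕ → H)
    (h : Summable fun k => ‖ξ k‖ * ‖η k‖) :
    Continuous[M.ultraweakTopology, inferInstance]
      (fun x : M.toStarSubalgebra => ∑' k, inner ℂ (η k) ((x : H →L[ℂ] H) (ξ k))) :=
  continuous_iInf_dom <| continuous_iInf_dom <| continuous_iInf_dom (i := h) continuous_induced_dom

theorem continuous_ultraweak_mul_right {M : VonNeumannAlgebra H} (t : M.toStarSubalgebra) :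
    Continuous[M.ultraweakTopology, M.ultraweakTopology] (fun x => x * t) := by
  refine continuous_to_ultraweak fun ξ η h => ?_
  refine continuous_ultraweak_tsum (fun k => (t : H →L[ℂ] H) (ξ k)) η ?_
  refine Summable.of_nonneg_of_le (fun k => by positivity) (fun k => ?_)
    (h.mul_left ‖(t : H →L[ℂ] H)‖)
  rw [← mul_assoc]
  gcongr
  exact (t : H →L[ℂ] H).le_opNorm _

theorem continuous_ultraweak_mul_left {M : VonNeumannAlgebra H} (t : M.toStarSubalgebra) :
    Continuous[M.ultraweakTopology, M.ultraweakTopology] (fun x => t * x) := by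
  refine continuous_to_ultraweak fun ξ η h => ?_
  have key := continuous_ultraweak_tsum (M := M) ξ
    (fun k => ContinuousLinearMap.adjoint (t : H →L[ℂ] H) (η k)) (by
      refine Summable.of_nonneg_of_le (fun k => by positivity) (fun k => ?_)
        (h.mul_left ‖ContinuousLinearMap.adjoint (t : H →L[ℂ] H)‖)
      rw [mul_left_comm]
      gcongr
      exact (ContinuousLinearMap.adjoint (t : H →L[ℂ] H)).le_opNorm _)
  simp only [ContinuousLinearMap.adjoint_inner_left] at key
  exact key

/-- For `t ∈ M` and `φ ∈ M_*`, the form `t φ ∈ M_*` given by `(t φ) x = φ (x t)`. -/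
noncomputable def leftMul {M : VonNeumannAlgebra H} (t : M.toStarSubalgebra) (φ : M.predual) : M.predual :=
  ⟨φ.1 ∘ₗ LinearMap.mulRight ℂ t,
    @Continuous.comp _ _ _ M.ultraweakTopology M.ultraweakTopology _ _ φ.1 φ.2
      (continuous_ultraweak_mul_right t)⟩

/-- For `t ∈ M` and `φ ∈ M_*`, the form `φ t ∈ M_*` given by `(φ t) x = φ (t x)`. -/
noncomputable def rightMul {M : VonNeumannAlgebra H} (φ : M.predual) (t : M.toStarSubalgebra) : M.predual :=
  ⟨φ.1 ∘ₗ LinearMap.mulLeft ℂ t,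
    @Continuous.comp _ _ _ M.ultraweakTopology M.ultraweakTopology _ _ φ.1 φ.2
      (continuous_ultraweak_mul_left t)⟩

/-- The set of all `ψ ∈ M_*` with `ψ ≥ φ i` for all `i`. -/
def majorants {M : VonNeumannAlgebra H} {n : ℕ} (φ : Fin n → M.predual) : Set M.predual :=
  {ψ | ∀ i, IsPositiveForm (ψ - φ i)}

/-- The set of all POVMs in `M` with `n` outputs: families of `n` positive operators in `M` that
sum to the identity. -/
def povms (M : VonNeumannAlgebra H) (n : ℕ) : Set (Fin n → M.toStarSubalgebra) :=
  {t | (∀ i, (t i : H →L[ℂ] H).IsPositive) ∧ ∑ i, t i = 1}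

end VonNeumannAlgebra

/-!
Weak duality is immediate: if `ψ ≥ φ i` for all `i` and `t` is a POVM, then
`ψ 1 - ∑ i, φ i (t i) = ∑ i, (ψ - φ i) (t i) ≥ 0`.

The supremum is attained because the set of POVMs is ultraweakly compact (`isCompact_povms`). Along
an ultrafilter, the matrix coefficients of operators of norm at most `1` converge to those of some
bounded operator; the limit stays in `M` because `M` is a bicommutant, and on bounded sets the
convergence is ultraweak by dominated convergence.

Strong duality needs no separation theorem: a maximizing POVM `t` yields the optimal majorant
`ψ = ∑ i, t i φ i` explicitly. To see that `ψ ≥ φ j`, take `s ∈ M` with `s + s⋆ ≥ 0` and replace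
each `t i` by `(1 - ε s)⋆ (t i) (1 - ε s)`. These operators sum to
`(1 + ε² ‖s‖²) - ε (s + s⋆) - ε² (‖s‖² - s⋆ s)`; adding the missing positive part to the `j`-th one
gives `1 + ε² ‖s‖²` times a POVM. The first order terms in `ε` of the maximality inequality give
`φ j (s + s⋆) ≤ Re ∑ i, φ i (s⋆ (t i) + (t i) s)` (`re_map_add_star_le`). For `a ≥ 0`, the choices
`s = ± i a` show that `ψ a` is real, and then `s = a` shows that `φ j a ≤ ψ a`.

Finally, for an optimal pair the nonnegative numbers `(ψ - φ i) (t i)` sum to zero, so each of them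
vanishes, and by the Cauchy–Schwarz inequality `ψ - φ i` vanishes on `M (t i)` and on `(t i) M`.
Summing over `i` gives the formulas for `ψ`.
-/

/-! ### Ultraweak compactness of the set of POVMs -/

open Filter in
/-- A bounded family of operators on a Hilbert space converges along every ultrafilter in the weak
operator topology: the limits of the matrix coefficients form a bounded sesquilinear form, which
represents the limit operator. -/
theorem ContinuousLinearMap.exists_tendsto_inner_of_ultrafilter {H : Type*} [NormedAddCommGroup H]
    [InnerProductSpace ℂ H] [CompleteSpace H] {α : Type*} (l : Ultrafilter α) (x : α → H →L[ℂ] H)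
    {C : ℝ} (hx : ∀ᶠ a in l, ‖x a‖ ≤ C) :
    ∃ T : H →L[ℂ] H, ∀ v w, Tendsto (fun a => inner ℂ w (x a v)) l (𝓝 (inner ℂ w (T v))) := by
  have hb : ∀ v w, ∀ᶠ a in l, ‖inner ℂ (x a v) w‖ ≤ C * ‖v‖ * ‖w‖ := fun v w =>
    hx.mono fun a ha => (norm_inner_le_norm _ _).trans <| by
      gcongr
      exact (x a).le_of_opNorm_le ha v
  have hlim : ∀ v w, ∃ z : ℂ, Tendsto (fun a => inner ℂ (x a v) w) l (𝓝 z) := fun v w => by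
    obtain ⟨z, -, hz⟩ := (isCompact_closedBall (0 : ℂ) (C * ‖v‖ * ‖w‖)).ultrafilter_le_nhds
      (l.map fun a => inner ℂ (x a v) w) (le_principal_iff.2 <|
        mem_map.2 <| (hb v w).mono fun a ha => mem_closedBall_zero_iff.2 ha)
    exact ⟨z, hz⟩
  choose B hB using hlim
  let B' : H →ₗ⋆[ℂ] H →ₗ[ℂ] ℂ := LinearMap.mk₂'ₛₗ (starRingEnd ℂ) (RingHom.id ℂ) B
    (fun u v w => tendsto_nhds_unique (hB _ _) <| by
      simpa [inner_add_left] using (hB u w).add (hB v w))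
    (fun c v w => tendsto_nhds_unique (hB _ _) <| by
      simpa [inner_smul_left, mul_comm] using (hB v w).const_mul (starRingEnd ℂ c))
    (fun u v w => tendsto_nhds_unique (hB _ _) <| by
      simpa [inner_add_right] using (hB u v).add (hB u w))
    (fun c v w => tendsto_nhds_unique (hB _ _) <| by
      simpa [inner_smul_right] using (hB v w).const_mul c)
  let B'' : H →L⋆[ℂ] H →L[ℂ] ℂ := B'.mkContinuous₂ C fun v w =>
    le_of_tendsto (hB v w).norm (hb v w)
  refine ⟨InnerProductSpace.continuousLinearMapOfBilin B'', fun v w => ?_⟩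
  rw [← inner_conj_symm, InnerProductSpace.continuousLinearMapOfBilin_apply]
  simpa [B'', B', Function.comp_def] using (Complex.continuous_conj.tendsto _).comp (hB v w)

namespace VonNeumannAlgebra

variable {H : Type*} [NormedAddCommGroup H] [InnerProductSpace ℂ H] [CompleteSpace H]
  {M : VonNeumannAlgebra H}

theorem mem_of_forall_centralizer {x : H →L[ℂ] H}
    (h : ∀ z ∈ Set.centralizer (M : Set (H →L[ℂ] H)), z * x = x * z) :
    x ∈ M.toStarSubalgebra := by
  rw [mem_carrier, ← M.centralizer_centralizer]
  exact h

/-- The square root of a positive operator of `M` lies in `M`, since it commutes with everything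
that commutes with the operator. -/
theorem exists_isSelfAdjoint_mul_self_eq {p : M.toStarSubalgebra} (hp : (p : H →L[ℂ] H).IsPositive) :
    ∃ r : M.toStarSubalgebra, IsSelfAdjoint r ∧ r * r = p := by
  have hp' : 0 ≤ (p : H →L[ℂ] H) := (ContinuousLinearMap.nonneg_iff_isPositive _).2 hp
  refine ⟨⟨CFC.sqrt (p : H →L[ℂ] H), mem_of_forall_centralizer fun z hz => ?_⟩, ?_, ?_⟩
  · have hz' : Commute (p : H →L[ℂ] H) z := hz _ p.2
    exact (hz'.cfcₙ_nnreal _).symm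
  · exact Subtype.ext (CFC.sqrt_nonneg (p : H →L[ℂ] H)).isSelfAdjoint
  · exact Subtype.ext (CFC.sqrt_mul_sqrt_self _ hp')

theorem isPositive_star_mul_self (x : M.toStarSubalgebra) :
    ((star x * x : M.toStarSubalgebra) : H →L[ℂ] H).IsPositive :=
  ContinuousLinearMap.isPositive_adjoint_comp_self (x : H →L[ℂ] H)

theorem isPositive_norm_sq_sub_star_mul_self (x : M.toStarSubalgebra) :
    ((((‖(x : H →L[ℂ] H)‖ ^ 2 : ℝ) : ℂ) • 1 - star x * x : M.toStarSubalgebra) :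
      H →L[ℂ] H).IsPositive := by
  have := CStarAlgebra.star_mul_le_algebraMap_norm_sq (a := (x : H →L[ℂ] H))
  rw [ContinuousLinearMap.le_def, Algebra.algebraMap_eq_smul_one] at this
  exact this

theorem norm_le_one_of_mem_povms {n : ℕ} {t : Fin n → M.toStarSubalgebra} (ht : t ∈ M.povms n)
    (i : Fin n) : ‖(t i : H →L[ℂ] H)‖ ≤ 1 := by
  have h0 : ∀ i, 0 ≤ (t i : H →L[ℂ] H) :=
    fun i => (ContinuousLinearMap.nonneg_iff_isPositive _).2 (ht.1 i)
  rw [CStarAlgebra.norm_le_one_iff_of_nonneg _ (h0 i)]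
  have hs : ∑ i, (t i : H →L[ℂ] H) = 1 := by
    simpa using congrArg (Subtype.val) ht.2
  rw [← hs]
  exact Finset.single_le_sum (f := fun i => (t i : H →L[ℂ] H)) (fun i _ => h0 i) (Finset.mem_univ i)

open Filter in
/-- On norm-bounded sets, weak operator convergence implies ultraweak convergence, by dominated
convergence. -/
theorem tendsto_ultraweak_of_tendsto_inner {α : Type*} {l : Filter α}
    {x : α → M.toStarSubalgebra} {y : M.toStarSubalgebra} {C : ℝ}
    (hx : ∀ᶠ a in l, ‖(x a : H →L[ℂ] H)‖ ≤ C)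
    (h : ∀ v w : H, Tendsto (fun a => inner ℂ w ((x a : H →L[ℂ] H) v)) l
      (𝓝 (inner ℂ w ((y : H →L[ℂ] H) v)))) :
    Tendsto x l (@nhds _ M.ultraweakTopology y) := by
  simp only [nhds_iInf, nhds_induced, tendsto_iInf, tendsto_comap_iff]
  intro ξ η hs
  refine tendsto_tsum_of_dominated_convergence (f := fun a k =>
    inner ℂ (η k) ((x a : H →L[ℂ] H) (ξ k))) (hs.mul_left C) (fun k => h _ _) ?_
  filter_upwards [hx] with a ha k
  calc ‖inner ℂ (η k) ((x a : H →L[ℂ] H) (ξ k))‖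
      ≤ ‖η k‖ * ‖(x a : H →L[ℂ] H) (ξ k)‖ := norm_inner_le_norm _ _
    _ ≤ ‖η k‖ * (C * ‖ξ k‖) := by
      gcongr
      exact (x a : H →L[ℂ] H).le_of_opNorm_le ha _
    _ = C * (‖ξ k‖ * ‖η k‖) := by ring

open Filter in
/-- The set of POVMs is compact for the product of the ultraweak topologies. -/
theorem isCompact_povms (M : VonNeumannAlgebra H) (n : ℕ) :
    @IsCompact _ (@Pi.topologicalSpace _ _ fun _ => M.ultraweakTopology) (M.povms n) := by
  refine (@isCompact_iff_ultrafilter_le_nhds' _ (_) _).2 fun l hl => ?_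
  have hnorm : ∀ i, ∀ᶠ t : Fin n → M.toStarSubalgebra in l, ‖(t i : H →L[ℂ] H)‖ ≤ 1 := fun i =>
    mem_of_superset hl fun t ht => norm_le_one_of_mem_povms ht i
  choose T hT using fun i => ContinuousLinearMap.exists_tendsto_inner_of_ultrafilter l
    (fun t : Fin n → M.toStarSubalgebra => (t i : H →L[ℂ] H)) (hnorm i)
  have hmem : ∀ i, T i ∈ M.toStarSubalgebra := fun i => mem_of_forall_centralizer fun z hz => by
    refine ContinuousLinearMap.ext fun v => ext_inner_left ℂ fun w => ?_
    refine tendsto_nhds_unique ?_ (hT i (z v) w)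
    have h := hT i v (ContinuousLinearMap.adjoint z w)
    simp only [ContinuousLinearMap.adjoint_inner_left] at h
    refine h.congr fun t => ?_
    exact congrArg (inner ℂ w) (DFunLike.congr_fun (hz _ (t i).2) v).symm
  refine ⟨fun i => ⟨T i, hmem i⟩, ⟨fun i => ?_, ?_⟩, ?_⟩
  · have h0 : ∀ v, 0 ≤ inner ℂ v (T i v) := fun v => ge_of_tendsto (hT i v v) <|
      mem_of_superset hl fun t ht => (ht.1 i).inner_nonneg_right v
    refine (ContinuousLinearMap.isPositive_iff_complex _).2 fun v => ?_
    obtain ⟨hre, him⟩ := Complex.nonneg_iff.1 (h0 v)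
    have e : inner ℂ (T i v) v = inner ℂ v (T i v) := by
      rw [← inner_conj_symm]
      exact Complex.conj_eq_iff_im.2 him.symm
    rw [e]
    exact ⟨Complex.ext rfl him, hre⟩
  · refine Subtype.ext (ContinuousLinearMap.ext fun v => ext_inner_left ℂ fun w => ?_)
    have h := tendsto_finsetSum Finset.univ fun i _ => hT i v w
    have h1 : (fun t : Fin n → M.toStarSubalgebra =>
        ∑ i, inner ℂ w ((t i : H →L[ℂ] H) v)) =ᶠ[l] fun _ => inner ℂ w v :=
      mem_of_superset hl fun t ht => by
        have := congrArg (fun x : M.toStarSubalgebra => inner ℂ w ((x : H →L[ℂ] H) v)) ht.2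
        simpa [inner_sum] using this
    simpa [inner_sum] using (tendsto_nhds_unique (h.congr' h1) tendsto_const_nhds)
  · rw [@nhds_pi]
    exact tendsto_pi.2 fun i => tendsto_ultraweak_of_tendsto_inner (hnorm i) (hT i)

end VonNeumannAlgebra

/-! ### Positive linear forms on unital *-algebras -/

section PositiveForm

variable {A : Type*} [Ring A] [StarRing A] [Algebra ℂ A] [StarModule ℂ A] {f : A →ₗ[ℂ] ℂ}

theorem LinearMap.map_star_of_nonneg (hf : ∀ x, 0 ≤ f (star x * x)) (x : A) :
    f (star x) = starRingEnd ℂ (f x) := by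
  have h1 := (Complex.nonneg_iff.1 (hf 1)).2
  have hx := (Complex.nonneg_iff.1 (hf x)).2
  have h2 := (Complex.nonneg_iff.1 (hf (1 + x))).2
  have h3 := (Complex.nonneg_iff.1 (hf (1 + Complex.I • x))).2
  simp only [star_add, star_one, star_smul, add_mul, mul_add, one_mul, mul_one, map_add, map_smul,
    smul_mul_assoc, mul_smul_comm, smul_eq_mul, Complex.add_im, Complex.mul_im, Complex.mul_re,
    Complex.I_re, Complex.I_im, RCLike.star_def, Complex.conj_I, Complex.neg_re,
    Complex.neg_im] at h1 hx h2 h3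
  apply Complex.ext <;> simp only [Complex.conj_re, Complex.conj_im] <;> linarith

/-- The degenerate case of the Cauchy–Schwarz inequality. -/
theorem LinearMap.map_mul_eq_zero_of_nonneg (hf : ∀ x, 0 ≤ f (star x * x)) {r : A}
    (hr : f (star r * r) = 0) (y : A) : f (y * r) = 0 := by
  -- If `B = f (y r) ≠ 0`, then `f (z⋆ z)` for `z = y⋆ - k (conj B) r` is affine in the real number
  -- `k` with slope `-2 |B|²`, so it is negative for some `k`.
  by_contra hB
  set B := f (y * r)
  have hB' : f (star r * star y) = starRingEnd ℂ B := by
    rw [← star_mul, LinearMap.map_star_of_nonneg hf]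
  have key : ∀ k : ℝ, 0 ≤ (f (y * star y)).re - 2 * (k * Complex.normSq B) := fun k => by
    have h := (Complex.nonneg_iff.1 (hf (star y - ((k : ℂ) * starRingEnd ℂ B) • r))).1
    have e : f (star (star y - ((k : ℂ) * starRingEnd ℂ B) • r) *
        (star y - ((k : ℂ) * starRingEnd ℂ B) • r)) =
        f (y * star y) - 2 * (k * Complex.normSq B) := by
      simp only [star_sub, star_star, star_smul, sub_mul, mul_sub, map_sub, map_smul,
        smul_mul_assoc, mul_smul_comm, smul_eq_mul, hr, hB', RCLike.star_def, map_mul,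
        Complex.conj_ofReal, Complex.conj_conj, Complex.normSq_eq_conj_mul_self]
      rw [show f (y * r) = B from rfl]
      ring
    rw [e] at h
    have e2 : (2 * (k * Complex.normSq B) : ℂ) = ((2 * (k * Complex.normSq B) : ℝ) : ℂ) := by
      push_cast; rfl
    rwa [e2, Complex.sub_re, Complex.ofReal_re] at h
  have hN : Complex.normSq B ≠ 0 := by simpa using hB
  have h1 := key (((f (y * star y)).re + 1) / Complex.normSq B)
  have h0 := key 0
  rw [div_mul_cancel₀ _ hN] at h1
  linarith

theorem star_one_sub_smul_mul_mul (ε : ℝ) (s t : A) :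
    star (1 - (ε : ℂ) • s) * t * (1 - (ε : ℂ) • s) =
      t - (ε : ℂ) • (star s * t + t * s) + ((ε ^ 2 : ℝ) : ℂ) • (star s * t * s) := by
  simp only [star_sub, star_one, star_smul, RCLike.star_def, Complex.conj_ofReal, sub_mul, mul_sub,
    one_mul, mul_one, smul_mul_assoc, mul_smul_comm, Complex.ofReal_pow]
  module

end PositiveForm

/-! ### Duality between majorants and POVMs -/

namespace VonNeumannAlgebra

variable {H : Type*} [NormedAddCommGroup H] [InnerProductSpace ℂ H] [CompleteSpace H]
  {M : VonNeumannAlgebra H}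

theorem IsPositiveForm.nonneg {φ : M.predual} (hφ : IsPositiveForm φ) {p : M.toStarSubalgebra}
    (hp : (p : H →L[ℂ] H).IsPositive) : 0 ≤ φ.1 p := by
  obtain ⟨r, hr, rfl⟩ := exists_isSelfAdjoint_mul_self_eq hp
  simpa [hr.star_eq] using hφ r

theorem IsPositiveForm.map_mul_eq_zero {φ : M.predual} (hφ : IsPositiveForm φ)
    {p : M.toStarSubalgebra} (hp : (p : H →L[ℂ] H).IsPositive) (h : φ.1 p = 0)
    (x : M.toStarSubalgebra) : φ.1 (x * p) = 0 ∧ φ.1 (p * x) = 0 := by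
  obtain ⟨r, hr, rfl⟩ := exists_isSelfAdjoint_mul_self_eq hp
  have key : ∀ x, φ.1 (x * (r * r)) = 0 := fun x => by
    rw [← mul_assoc]
    exact LinearMap.map_mul_eq_zero_of_nonneg hφ (by rwa [hr.star_eq]) _
  refine ⟨key x, ?_⟩
  have h2 := LinearMap.map_star_of_nonneg hφ (star x * (r * r))
  rwa [key, map_zero, star_mul, star_star, star_mul, hr.star_eq] at h2

theorem sum_mul_povm {n : ℕ} {t : Fin n → M.toStarSubalgebra} (ht : t ∈ M.povms n)
    (f : M.toStarSubalgebra →ₗ[ℂ] ℂ) (x : M.toStarSubalgebra) :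
    ∑ i, f (x * t i) = f x ∧ ∑ i, f (t i * x) = f x := by
  rw [← map_sum, ← map_sum, ← Finset.mul_sum, ← Finset.sum_mul, ht.2, mul_one, one_mul]
  exact ⟨rfl, rfl⟩

theorem map_one_sub_sum_eq {n : ℕ} {t : Fin n → M.toStarSubalgebra} (ht : t ∈ M.povms n)
    (φ : Fin n → M.predual) (ψ : M.predual) :
    ψ.1 1 - ∑ i, (φ i).1 (t i) = ∑ i, (ψ - φ i).1 (t i) := by
  have h := (sum_mul_povm ht ψ.1 1).1
  simp only [one_mul] at h
  rw [← h, ← Finset.sum_sub_distrib]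
  rfl

theorem sum_le_map_one {n : ℕ} {t : Fin n → M.toStarSubalgebra} (ht : t ∈ M.povms n)
    {φ : Fin n → M.predual} {ψ : M.predual} (hψ : ψ ∈ majorants φ) :
    ∑ i, (φ i).1 (t i) ≤ ψ.1 1 := by
  rw [← sub_nonneg, map_one_sub_sum_eq ht]
  exact Finset.sum_nonneg fun i _ => (hψ i).nonneg (ht.1 i)

/-- Complementary slackness: if a majorant `ψ` and a POVM `t` give the same value, then `ψ` and
`φ i` agree on `M (t i)` and on `(t i) M`. -/
theorem map_mul_eq_of_sum_eq {n : ℕ} {t : Fin n → M.toStarSubalgebra} (ht : t ∈ M.povms n)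
    {φ : Fin n → M.predual} {ψ : M.predual} (hψ : ψ ∈ majorants φ)
    (h : ∑ i, (φ i).1 (t i) = ψ.1 1) (i : Fin n) (x : M.toStarSubalgebra) :
    ψ.1 (x * t i) = (φ i).1 (x * t i) ∧ ψ.1 (t i * x) = (φ i).1 (t i * x) := by
  have h0 := map_one_sub_sum_eq ht φ ψ
  rw [h, sub_self, eq_comm,
    Finset.sum_eq_zero_iff_of_nonneg fun i _ => (hψ i).nonneg (ht.1 i)] at h0
  obtain ⟨h1, h2⟩ := (hψ i).map_mul_eq_zero (ht.1 i) (h0 i (Finset.mem_univ i)) x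
  exact ⟨sub_eq_zero.1 h1, sub_eq_zero.1 h2⟩

theorem exists_povm_forall_re_sum_le {n : ℕ} (hn : 1 ≤ n) (φ : Fin n → M.predual) :
    ∃ t ∈ M.povms n, ∀ p ∈ M.povms n,
      (∑ i, (φ i).1 (p i)).re ≤ (∑ i, (φ i).1 (t i)).re := by
  let _ := M.ultraweakTopology
  refine IsCompact.exists_isMaxOn (f := fun p : Fin n → M.toStarSubalgebra =>
    (∑ i, (φ i).1 (p i)).re) (isCompact_povms M n) ?_ (Continuous.continuousOn ?_)
  · refine ⟨Pi.single ⟨0, hn⟩ 1, fun i => ?_, by simp⟩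
    by_cases h : i = ⟨0, hn⟩
    · subst h
      simp
    · simp [h]
  · exact Complex.continuous_re.comp
      (continuous_finsetSum _ fun i _ => Continuous.comp (φ i).2 (continuous_apply i))

/-! ### The majorant given by a maximizing POVM -/

variable {n : ℕ} {φ : Fin n → M.predual} {t : Fin n → M.toStarSubalgebra}

/-- The homogeneous form of maximality, for positive families that sum to a multiple of `1`. -/
theorem re_sum_le_mul_of_sum_eq_smul {m : ℝ}
    (hmax : ∀ p ∈ M.povms n, (∑ i, (φ i).1 (p i)).re ≤ m)
    {p : Fin n → M.toStarSubalgebra} (hp : ∀ i, (p i : H →L[ℂ] H).IsPositive) {c : ℝ} (hc : 0 < c)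
    (hsum : ∑ i, p i = (c : ℂ) • 1) : (∑ i, (φ i).1 (p i)).re ≤ c * m := by
  have hc' : (c : ℂ) ≠ 0 := by exact_mod_cast hc.ne'
  have h := hmax (fun i => ((c⁻¹ : ℝ) : ℂ) • p i)
    ⟨fun i => (hp i).smul_of_nonneg (by exact_mod_cast (inv_pos.2 hc).le), by
      rw [← Finset.smul_sum, hsum, smul_smul]
      simp [hc']⟩
  simp only [map_smul, smul_eq_mul, ← Finset.mul_sum, Complex.re_ofReal_mul] at h
  rwa [inv_mul_le_iff₀ hc] at h

/-- The first order optimality condition for a POVM `t` that maximizes `∑ i, φ i (t i)`, in the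
direction `s`. -/
theorem re_map_add_star_le (ht : t ∈ M.povms n)
    (hmax : ∀ p ∈ M.povms n, (∑ i, (φ i).1 (p i)).re ≤ (∑ i, (φ i).1 (t i)).re)
    (j : Fin n) {s : M.toStarSubalgebra}
    (hs : ((s + star s : M.toStarSubalgebra) : H →L[ℂ] H).IsPositive) :
    ((φ j).1 (s + star s)).re ≤ (∑ i, (φ i).1 (star s * t i + t i * s)).re := by
  set K : ℝ := ‖(s : H →L[ℂ] H)‖ ^ 2
  set m : ℝ := (∑ i, (φ i).1 (t i)).re
  set q : M.toStarSubalgebra := (K : ℂ) • 1 - star s * s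
  set P : ℝ := (∑ i, (φ i).1 (star s * t i + t i * s)).re
  set Q : ℝ := (∑ i, (φ i).1 (star s * t i * s)).re
  set R : ℝ := ((φ j).1 (s + star s)).re
  set S : ℝ := ((φ j).1 q).re
  -- Maximality applied to the perturbation of `t` by `1 - ε s`: the terms of order zero cancel.
  have key : ∀ ε : ℝ, 0 < ε → (R - P) * ε ≤ (K * m - Q - S) * ε ^ 2 := fun ε hε => by
    set v : M.toStarSubalgebra := 1 - (ε : ℂ) • s with hv
    -- `w = (1 + ε² K) - v⋆ v`, which completes the sum of the perturbed family
    set w : M.toStarSubalgebra := (ε : ℂ) • (s + star s) + ((ε ^ 2 : ℝ) : ℂ) • q with hw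
    have hwpos : (w : H →L[ℂ] H).IsPositive :=
      (hs.smul_of_nonneg (by exact_mod_cast hε.le)).add
        ((isPositive_norm_sq_sub_star_mul_self s).smul_of_nonneg (by exact_mod_cast sq_nonneg ε))
    have h := re_sum_le_mul_of_sum_eq_smul (φ := φ) hmax
      (p := fun i => star v * t i * v + (Pi.single j w : Fin n → M.toStarSubalgebra) i)
      (c := 1 + ε ^ 2 * K) (fun i => ?_) (by positivity) ?_
    · have e : ∑ i, (φ i).1 (star v * t i * v + (Pi.single j w : Fin n → M.toStarSubalgebra) i) =
          (∑ i, (φ i).1 (t i)) - ε * (∑ i, (φ i).1 (star s * t i + t i * s)) +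
            ((ε ^ 2 : ℝ) : ℂ) * (∑ i, (φ i).1 (star s * t i * s)) +
            (ε * (φ j).1 (s + star s) + ((ε ^ 2 : ℝ) : ℂ) * (φ j).1 q) := by
        have hj : ∑ i, (φ i).1 ((Pi.single j w : Fin n → M.toStarSubalgebra) i) = (φ j).1 w := by
          rw [Finset.sum_eq_single j (fun i _ h => by simp [h]) (by simp), Pi.single_eq_same]
        simp only [map_add (φ _).1, Finset.sum_add_distrib, hj]
        simp only [hv, hw, star_one_sub_smul_mul_mul, map_add, map_sub, map_smul, smul_eq_mul,
          Finset.sum_add_distrib, Finset.sum_sub_distrib, ← Finset.mul_sum]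
      rw [e] at h
      simp only [Complex.add_re, Complex.sub_re, Complex.re_ofReal_mul] at h
      change m - ε * P + ε ^ 2 * Q + (ε * R + ε ^ 2 * S) ≤ _ at h
      linarith
    · refine ContinuousLinearMap.IsPositive.add ?_ ?_
      · exact (ht.1 i).adjoint_conj (v : H →L[ℂ] H)
      · by_cases h : i = j
        · subst h
          simpa using hwpos
        · simp [h]
    · rw [Finset.sum_add_distrib, ← Finset.sum_mul, ← Finset.mul_sum, ht.2, Finset.sum_pi_single']
      simp only [hv, hw, q, star_one_sub_smul_mul_mul, Finset.mem_univ, if_true]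
      push_cast
      simp only [mul_one, one_mul]
      module
  -- An `ε` of the order of `R - P` contradicts `key` if `R - P > 0`.
  by_contra! hlt
  have hD : 0 < R - P := sub_pos.2 hlt
  have hC : 0 < |K * m - Q - S| + 1 := by positivity
  have h1 := key ((R - P) / (|K * m - Q - S| + 1)) (by positivity)
  rw [sq, ← mul_assoc] at h1
  have h2 := le_of_mul_le_mul_right h1 (by positivity)
  have h3 : (K * m - Q - S) * ((R - P) / (|K * m - Q - S| + 1)) ≤
      |K * m - Q - S| * ((R - P) / (|K * m - Q - S| + 1)) := by
    gcongr
    exact le_abs_self _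
  have h4 : |K * m - Q - S| * ((R - P) / (|K * m - Q - S| + 1)) < R - P := by
    rw [← mul_div_assoc, div_lt_iff₀ hC]
    nlinarith
  linarith

theorem sum_leftMul_apply (φ : Fin n → M.predual) (t : Fin n → M.toStarSubalgebra)
    (x : M.toStarSubalgebra) :
    (∑ i, leftMul (t i) (φ i)).1 x = ∑ i, (φ i).1 (x * t i) := by
  rw [Submodule.coe_sum, LinearMap.sum_apply]
  rfl

theorem sum_rightMul_apply (φ : Fin n → M.predual) (t : Fin n → M.toStarSubalgebra)
    (x : M.toStarSubalgebra) :
    (∑ i, rightMul (φ i) (t i)).1 x = ∑ i, (φ i).1 (t i * x) := by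
  rw [Submodule.coe_sum, LinearMap.sum_apply]
  rfl

/-- A maximizing POVM `t` yields the majorant `∑ i, t i φ i` of the family `φ`. -/
theorem sum_leftMul_mem_majorants (hφ : ∀ i, IsPositiveForm (φ i)) (ht : t ∈ M.povms n)
    (hmax : ∀ p ∈ M.povms n, (∑ i, (φ i).1 (p i)).re ≤ (∑ i, (φ i).1 (t i)).re) :
    ∑ i, leftMul (t i) (φ i) ∈ majorants φ := by
  intro j x
  set a := star x * x with ha
  have hsa : star a = a := by simp [ha]
  have hapos : (a : H →L[ℂ] H).IsPositive := isPositive_star_mul_self x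
  set X := ∑ i, (φ i).1 (a * t i)
  set Y := ∑ i, (φ i).1 (t i * a)
  have hXY : Y = starRingEnd ℂ X := by
    rw [map_sum]
    refine Finset.sum_congr rfl fun i _ => ?_
    have hti : star (t i) = t i := Subtype.ext (ht.1 i).isSelfAdjoint
    rw [← LinearMap.map_star_of_nonneg (hφ i), star_mul, hsa, hti]
  have hpos : ((φ j).1 (a + a)).re ≤ (X + Y).re := by
    have h := re_map_add_star_le ht hmax j (s := a) (by rw [hsa]; exact hapos.add hapos)
    simpa only [hsa, map_add, Finset.sum_add_distrib] using h
  -- For imaginary `z`, the direction `s = z a` satisfies `s + s⋆ = 0`.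
  have hcomm : ∀ z : ℂ, starRingEnd ℂ z = -z → 0 ≤ (-z * X + z * Y).re := fun z hz => by
    have hs : z • a + star (z • a) = 0 := by
      rw [star_smul, hsa, RCLike.star_def, hz, neg_smul, add_neg_cancel]
    have h := re_map_add_star_le ht hmax j (s := z • a) (by
      rw [hs]; exact ContinuousLinearMap.isPositive_zero)
    rw [hs, star_smul, hsa, RCLike.star_def, hz] at h
    simpa only [map_zero, Complex.zero_re, smul_mul_assoc, mul_smul_comm, map_add, map_smul,
      smul_eq_mul, Finset.sum_add_distrib, ← Finset.mul_sum] using h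
  have h1 := hcomm Complex.I (by simp)
  have h2 := hcomm (-Complex.I) (by simp)
  rw [hXY] at h1 h2 hpos
  have hX : X.im = 0 := by
    simp at h1 h2
    linarith
  obtain ⟨-, him⟩ := Complex.nonneg_iff.1 (hφ j x)
  change 0 ≤ (∑ i, leftMul (t i) (φ i)).1 a - (φ j).1 a
  rw [sum_leftMul_apply, Complex.nonneg_iff, Complex.sub_re, Complex.sub_im, ← him]
  change 0 ≤ X.re - _ ∧ 0 = X.im - _
  rw [hX, sub_zero]
  refine ⟨?_, rfl⟩
  simp only [map_add, Complex.add_re, Complex.conj_re] at hpos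
  linarith

end VonNeumannAlgebra

theorem proposition7p1 {H : Type*} [NormedAddCommGroup H] [InnerProductSpace ℂ H] [CompleteSpace H]
    (M : VonNeumannAlgebra H) {n : ℕ} (hn : 1 ≤ n) (φ : Fin n → M.predual)
    (hφ : ∀ i, VonNeumannAlgebra.IsPositiveForm (φ i)) :
    ∃ m : ℝ,
      -- the infimum and the supremum are both equal to `m`, and both are attained
      IsLeast ((fun ψ : M.predual => ψ.1 1) '' VonNeumannAlgebra.majorants φ) (m : ℂ) ∧
      IsGreatest ((fun t : Fin n → M.toStarSubalgebra => ∑ i, (φ i).1 (t i)) '' M.povms n)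
        (m : ℂ) ∧
      -- every minimizer `ψ` and every maximizer `t`
      ∀ ψ ∈ VonNeumannAlgebra.majorants φ, ψ.1 1 = (m : ℂ) →
        ∀ t ∈ M.povms n, ∑ i, (φ i).1 (t i) = (m : ℂ) →
          (∀ i, VonNeumannAlgebra.leftMul (t i) ψ = VonNeumannAlgebra.leftMul (t i) (φ i)) ∧
          (∀ i, VonNeumannAlgebra.rightMul ψ (t i) = VonNeumannAlgebra.rightMul (φ i) (t i)) ∧
          ψ = ∑ i, VonNeumannAlgebra.leftMul (t i) (φ i) ∧
          ψ = ∑ i, VonNeumannAlgebra.rightMul (φ i) (t i) := by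
  obtain ⟨t, ht, hmax⟩ := VonNeumannAlgebra.exists_povm_forall_re_sum_le hn φ
  have hψ := VonNeumannAlgebra.sum_leftMul_mem_majorants hφ ht hmax
  have hm : (((∑ i, (φ i).1 (t i)).re : ℝ) : ℂ) = ∑ i, (φ i).1 (t i) :=
    Complex.ext rfl
      (Complex.nonneg_iff.1 (Finset.sum_nonneg fun i _ => (hφ i).nonneg (ht.1 i))).2
  have hψ1 : (∑ i, VonNeumannAlgebra.leftMul (t i) (φ i)).1 1 = ∑ i, (φ i).1 (t i) := by
    simp only [VonNeumannAlgebra.sum_leftMul_apply, one_mul]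
  refine ⟨(∑ i, (φ i).1 (t i)).re, ?_, ?_, ?_⟩
  · rw [hm]
    refine ⟨⟨_, hψ, hψ1⟩, ?_⟩
    rintro _ ⟨ψ, hψ', rfl⟩
    exact VonNeumannAlgebra.sum_le_map_one ht hψ'
  · rw [hm]
    refine ⟨⟨t, ht, rfl⟩, ?_⟩
    rintro _ ⟨p, hp, rfl⟩
    exact (VonNeumannAlgebra.sum_le_map_one hp hψ).trans_eq hψ1
  · intro ψ hψ' hψm p hp hpm
    have key := VonNeumannAlgebra.map_mul_eq_of_sum_eq hp hψ' (hpm.trans hψm.symm)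
    refine ⟨fun i => ?_, fun i => ?_, ?_, ?_⟩
    · exact Subtype.ext (LinearMap.ext fun x => (key i x).1)
    · exact Subtype.ext (LinearMap.ext fun x => (key i x).2)
    · refine Subtype.ext (LinearMap.ext fun x => ?_)
      rw [VonNeumannAlgebra.sum_leftMul_apply, ← (VonNeumannAlgebra.sum_mul_povm hp ψ.1 x).1]
      exact Finset.sum_congr rfl fun i _ => (key i x).1
    · refine Subtype.ext (LinearMap.ext fun x => ?_)
      rw [VonNeumannAlgebra.sum_rightMul_apply, ← (VonNeumannAlgebra.sum_mul_povm hp ψ.1 x).2]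
      exact Finset.sum_congr rfl fun i _ => (key i x).2
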